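/- Let $M,J\ge 1$ be integers, $H\in(0,1)$, $\sigma>0$, $\alpha\in[0,1]$ and $p\in(0,1/2)$. For every signal size $N=2Mn$, $n\ge1$, let $d_{j,k}=d^{(N)}_{j,k}$ ($1\le j\le J$, $1\le k\le N$) be random variables on a probability space (the non-decimated wavelet coefficients at levels $1,\dots,J$ of a fractional Brownian motion of size $N$ with Hurst exponent $H$), and put $$D_{j,k}=\tfrac12\bigl(d_{j,k}^2+d_{j,k+N/2}^2\bigr)\quad(1\le k\le N/2),\qquad \lambda_j=\sigma^2\,2^{-(2H+1)j}.$$ Assume that, for every $N=2Mn$ and every $1\le j\le J$, * for each $1\le k\le N/2$ the coefficients $d_{j,k}$ and $d_{j,k+N/2}$ are i.i.d. $\mathcal N(0,\lambda_j)$; * for each $1\le i\le M$ the $n=N/(2M)$ mid-energies $D_{j,i},D_{j,i+M},D_{j,i+2M},\dots,D_{j,N/2-M+i}$ of the $i$-th subgroup are independent. For a sample $X_1,\dots,X_n$ with order statistics $X_{1:n}\le\dots\le X_{n:n}$ let $Y_q=X_{\lfloor nq\rfloor:n}$, and let the general trimean estimator be $\frac{\alpha}{2}Y_p+(1-\alpha)Y_{1/2}+\frac{\alpha}{2}Y_{1-p}$.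 Let $\hat\mu_{j,i}$ be the general trimean estimator of the $i$-th subgroup of mid-energies at level $j$. Put $$c(\alpha,p)=\frac{\alpha}{2}\log\frac{1}{p(1-p)}+(1-\alpha)\log 2,\qquad f(\alpha,p)=\frac{\alpha(1-2p)(\alpha-4p)}{4p(1-p)}+1 .$$ (1) $f(\alpha,p)>0$, and for all $1\le j\le J$ and $1\le i\le M$ the estimator $\hat\mu_{j,i}$ is asymptotically normal with mean $c(\alpha,p)\lambda_j$ and variance $\frac{2M}{N}f(\alpha,p)\lambda_j^2$, that is, as $N\to\infty$ (with $M$ fixed and $2M\mid N$), $$\sqrt{\tfrac{N}{2M}}\,\bigl(\hat\mu_{j,i}-c(\alpha,p)\lambda_j\bigr)\ \longrightarrow\ \mathcal N\bigl(0,\,f(\alpha,p)\lambda_j^2\bigr)\quad\text{in distribution.}$$ (2) Let $S\subseteq\{1,\dots,J\}$ be any set of at least two levels. Let $\hat\beta_i$ be the slope of the least squares linear regression on the pairs $(j,\log_2\hat\mu_{j,i})$, $j\in S$, and let $\bar\beta=\frac1M\sum_{i=1}^M\hat\beta_i$ and $\hat H_i=-\frac{\hat\beta_i}{2}-\frac12$.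 Then the least squares slope $\beta$ of the pairs $(j,\log_2(c(\alpha,p)\lambda_j))$, $j\in S$, satisfies $-\frac{\beta}{2}-\frac12=H$; the estimator of $H$ is $$\hat H=\frac1M\sum_{i=1}^M\hat H_i=-\frac{\bar\beta}{2}-\frac12;$$ and it is consistent: $\hat H_i\to H$ for each $1\le i\le M$, and $\hat H\to H$, in probability as $N\to\infty$. -/

import Mathlib

open MeasureTheory ProbabilityTheory Filter Topology

namespace GTME

noncomputable section

/-- The `k`-th order statistic `X_{k:n}` (the `k`-th smallest value, `1 ≤ k ≤ n`) of a sample of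
size `n`. Outside that range of `k` it is set to `0`. -/
def orderStat {n : ℕ} (x : Fin n → ℝ) (k : ℕ) : ℝ :=
  if h : 1 ≤ k ∧ k ≤ n then x (Tuple.sort x ⟨k - 1, by omega⟩) else 0

/-- The sample `p`-th quantile `Y_p = X_{⌊np⌋:n}`. For `p ∈ (0, 1)` the order `⌊np⌋` is a genuine
one as soon as `n ≥ 1 / p`. -/
def sampleQuantile {n : ℕ} (x : Fin n → ℝ) (p : ℝ) : ℝ :=
  orderStat x ⌊(n : ℝ) * p⌋₊

/-- The general trimean estimator `(α/2) Y_p + (1 - α) Y_{1/2} + (α/2) Y_{1-p}`. -/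
def generalTrimean {n : ℕ} (α p : ℝ) (x : Fin n → ℝ) : ℝ :=
  α / 2 * sampleQuantile x p + (1 - α) * sampleQuantile x (1 / 2)
    + α / 2 * sampleQuantile x (1 - p)

/-- The mid-energy `D_k = (d_k² + d_{k+N/2}²) / 2` of the coefficients `d_1, …, d_N` of one level. -/
def midEnergy (N : ℕ) (d : ℕ → ℝ) (k : ℕ) : ℝ :=
  (d k ^ 2 + d (k + N / 2) ^ 2) / 2

/-- The `i`-th subgroup `D_i, D_{i+M}, D_{i+2M}, …, D_{N/2-M+i}` of the mid-energies of one level,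
for signal size `N = 2 M n`, so that the subgroup has `n = (N/2)/M` members. -/
def subgroup (M n : ℕ) (d : ℕ → ℝ) (i : ℕ) : Fin n → ℝ :=
  fun t => midEnergy (2 * M * n) d (i + t * M)

/-- The general trimean estimator of the `i`-th subgroup of mid-energies of one level. -/
def muHat (α p : ℝ) (M n : ℕ) (d : ℕ → ℝ) (i : ℕ) : ℝ :=
  generalTrimean α p (subgroup M n d i)

/-- `λ_j = σ² 2^{-(2H+1)j}`. -/
def lam (σ H : ℝ) (j : ℕ) : ℝ := σ ^ 2 * (2 : ℝ) ^ (-(2 * H + 1) * (j : ℝ))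

/-- `c(α, p)`. -/
def cCoef (α p : ℝ) : ℝ := α / 2 * Real.log (1 / (p * (1 - p))) + (1 - α) * Real.log 2

/-- `f(α, p)`. -/
def fCoef (α p : ℝ) : ℝ := α * (1 - 2 * p) * (α - 4 * p) / (4 * p * (1 - p)) + 1

/-- The slope of the least squares regression line through the points `(j, y j)`, `j ∈ S`. -/
def lsSlope (S : Finset ℕ) (y : ℕ → ℝ) : ℝ :=
  (∑ j ∈ S, ((j : ℝ) - (∑ l ∈ S, (l : ℝ)) / S.card) * (y j - (∑ l ∈ S, y l) / S.card)) /
    ∑ j ∈ S, ((j : ℝ) - (∑ l ∈ S, (l : ℝ)) / S.card) ^ 2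

/-- The slope `β̂_i` of the regression of `log₂ μ̂_{j,i}` on the levels `j ∈ S`; here `d j k` is the
`k`-th coefficient at level `j`. -/
def betaHat (α p : ℝ) (M n : ℕ) (S : Finset ℕ) (d : ℕ → ℕ → ℝ) (i : ℕ) : ℝ :=
  lsSlope S fun j => Real.logb 2 (muHat α p M n (d j) i)

/-- `Ĥ_i = -β̂_i / 2 - 1 / 2`. -/
def hurstHatGroup (α p : ℝ) (M n : ℕ) (S : Finset ℕ) (d : ℕ → ℕ → ℝ) (i : ℕ) : ℝ :=
  -betaHat α p M n S d i / 2 - 1 / 2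

/-- `Ĥ = (1/M) ∑_{i=1}^M Ĥ_i`. -/
def hurstHat (α p : ℝ) (M n : ℕ) (S : Finset ℕ) (d : ℕ → ℕ → ℝ) : ℝ :=
  1 / (M : ℝ) * ∑ i ∈ Finset.Icc 1 M, hurstHatGroup α p M n S d i

/-- `β̄ = (1/M) ∑_{i=1}^M β̂_i`. -/
def betaBar (α p : ℝ) (M n : ℕ) (S : Finset ℕ) (d : ℕ → ℕ → ℝ) : ℝ :=
  1 / (M : ℝ) * ∑ i ∈ Finset.Icc 1 M, betaHat α p M n S d i

end

end GTME

namespace GTME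

/-! ### Order statistics -/

/-! Half the squared norm of two independent `N(0, λ)` variables is exponential with mean `λ`
(`hasLaw_half_sq_add_sq`), so each subgroup is an i.i.d. exponential sample, whose `q`-quantile is
`ξ = -λ log (1 - q)` with density `(1 - q) / λ` there.

The event that a sample quantile is at most `ξ + y / √n` is an event about the empirical
distribution function at that moving point. Chebyshev's inequality lets the point be replaced by
`ξ`, and Ghosh's lemma (`tendstoInMeasure_sub_of_tight`) turns this into the Bahadur representation
`tendstoInMeasure_sampleQuantile`. The trimean is then, up to `o_P(n^{-1/2})`, its centre plus the
centred mean of one function, a combination of three indicators. The scalar central limit theorem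
therefore suffices, and the variance of that function is `f(α, p) λ²`.

Asymptotic normality gives consistency of each trimean. The logarithm is continuous at `c λ_j > 0`,
the regression slope is linear in the ordinates, and `log₂ (c λ_j)` is affine in `j` with slope
`-(2H + 1)`; so limits pass through to `H` with no assumption on dependence between levels or
subgroups. -/

lemma orderStat_le_iff {n : ℕ} (x : Fin n → ℝ) {k : ℕ} (hk : 1 ≤ k) (hkn : k ≤ n) (y : ℝ) :
    orderStat x k ≤ y ↔ k ≤ (Finset.univ.filter (fun t => x t ≤ y)).card := by
  have hcard : (Finset.univ.filter (fun t => x (Tuple.sort x t) ≤ y)).card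
      = (Finset.univ.filter (fun t => x t ≤ y)).card := by
    refine Finset.card_bij (fun t _ => Tuple.sort x t) (by simp) (by simp) ?_
    intro b hb
    exact ⟨(Tuple.sort x).symm b, by simpa using hb, by simp⟩
  rw [orderStat, dif_pos ⟨hk, hkn⟩, ← hcard]
  have := Tuple.lt_card_le_iff_apply_le_of_monotone (j := ⟨k - 1, by omega⟩) (a := y)
    (Tuple.monotone_sort x)
  simp only [Function.comp_apply] at this
  rw [← this]
  omega

lemma measurable_orderStat (n k : ℕ) : Measurable (fun x : Fin n → ℝ => orderStat x k) := by
  by_cases h : 1 ≤ k ∧ k ≤ n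
  · refine measurable_of_Iic fun y => ?_
    have : (fun x : Fin n → ℝ => orderStat x k) ⁻¹' Set.Iic y
        = {x | k ≤ ∑ t, (Set.Iic y).indicator (fun _ => 1) (x t)} := by
      ext x
      rw [Set.mem_preimage, Set.mem_Iic, orderStat_le_iff x h.1 h.2, Finset.card_filter]
      simp [Set.indicator_apply]
    rw [this]
    refine measurableSet_le measurable_const (Finset.measurable_sum _ fun t _ => ?_)
    exact (measurable_const.indicator measurableSet_Iic).comp (measurable_pi_apply t)
  · simp only [orderStat, dif_neg h]
    exact measurable_const

lemma measurable_sampleQuantile (n : ℕ) (q : ℝ) :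
    Measurable (fun x : Fin n → ℝ => sampleQuantile x q) :=
  measurable_orderStat n _

lemma measurable_generalTrimean (n : ℕ) (α p : ℝ) :
    Measurable (fun x : Fin n → ℝ => generalTrimean α p x) := by
  have h := measurable_sampleQuantile n
  exact (((h p).const_mul _).add ((h (1 / 2)).const_mul _)).add ((h (1 - p)).const_mul _)

/-! ### Ghosh's lemma -/

/-- If `W` is tight and the events `V ≤ y` and `W ≤ y` asymptotically agree up to an arbitrarily
small shift, then `V - W` tends to zero in probability. -/
theorem tendstoInMeasure_sub_of_tight {Ω : Type*} {mΩ : MeasurableSpace Ω} {P : Measure Ω}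
    {V W : ℕ → Ω → ℝ}
    (htight : ∀ δ : ENNReal, 0 < δ → ∃ K : ℝ, ∀ n, P {ω | K ≤ |W n ω|} ≤ δ)
    (hVW : ∀ y ε : ℝ, 0 < ε → Tendsto (fun n => P {ω | V n ω ≤ y ∧ y + ε ≤ W n ω}) atTop (𝓝 0))
    (hWV : ∀ y ε : ℝ, 0 < ε → Tendsto (fun n => P {ω | W n ω ≤ y ∧ y + ε ≤ V n ω}) atTop (𝓝 0)) :
    TendstoInMeasure P (V - W) atTop 0 := by
  rw [tendstoInMeasure_iff_norm]
  intro ε hε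
  simp only [Pi.sub_apply, Pi.zero_apply, sub_zero, Real.norm_eq_abs]
  rw [ENNReal.tendsto_nhds_zero]
  intro δ hδ
  obtain ⟨K, hK⟩ := htight (δ / 2) (ENNReal.half_pos hδ.ne')
  -- Cut the line into cells of length `η`. If `W` lies in `[mη, (m+1)η)` and `|V - W| ≥ 2η`, a full
  -- cell separates the two: either `V ≤ (m-1)η` and `mη ≤ W`, or `W ≤ (m+1)η` and `(m+2)η ≤ V`.
  -- Tightness leaves only finitely many cells, `|m| ≤ L`.
  set η := ε / 2 with hη
  have hη0 : 0 < η := by positivity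
  set L : ℤ := ⌈K / η⌉ + 1 with hL
  have hlim : Tendsto (fun n => ∑ m ∈ Finset.Icc (-L) L,
      (P {ω | V n ω ≤ (m - 1) * η ∧ (m - 1) * η + η ≤ W n ω}
        + P {ω | W n ω ≤ (m + 1) * η ∧ (m + 1) * η + η ≤ V n ω})) atTop (𝓝 0) := by
    have := tendsto_finsetSum (Finset.Icc (-L) L) (fun (m : ℤ) _ =>
      (hVW ((m - 1) * η) η hη0).add (hWV ((m + 1) * η) η hη0))
    simpa using this
  filter_upwards [ENNReal.tendsto_nhds_zero.1 hlim (δ / 2) (ENNReal.half_pos hδ.ne')] with n hn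
  have hsub : {ω | ε ≤ |V n ω - W n ω|} ⊆ {ω | K ≤ |W n ω|} ∪
      ⋃ m ∈ Finset.Icc (-L) L, ({ω | V n ω ≤ (m - 1) * η ∧ (m - 1) * η + η ≤ W n ω} ∪
        {ω | W n ω ≤ (m + 1) * η ∧ (m + 1) * η + η ≤ V n ω}) := by
    intro ω hω
    simp only [Set.mem_ofPred_eq] at hω
    by_cases hKW : K ≤ |W n ω|
    · exact Or.inl hKW
    refine Or.inr ?_
    push Not at hKW
    obtain ⟨h1, h2⟩ := abs_lt.1 hKW
    have hm1 := Int.floor_le (W n ω / η)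
    have hm2 := Int.lt_floor_add_one (W n ω / η)
    set m := ⌊W n ω / η⌋
    rw [le_div_iff₀ hη0] at hm1
    rw [div_lt_iff₀ hη0] at hm2
    have hc : K / η ≤ ⌈K / η⌉ := Int.le_ceil _
    rw [div_le_iff₀ hη0] at hc
    have hmL : (m : ℝ) < L := by
      rw [hL]; push_cast
      nlinarith
    have hmL' : (-L : ℝ) ≤ m := by
      rw [hL]; push_cast
      nlinarith
    simp only [Set.mem_iUnion]
    refine ⟨m, Finset.mem_Icc.2 ⟨by exact_mod_cast hmL', by exact_mod_cast hmL.le⟩, ?_⟩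
    rcases le_abs.1 hω with h | h
    · right
      constructor <;> nlinarith
    · left
      constructor <;> nlinarith
  calc P {ω | ε ≤ |V n ω - W n ω|} ≤ _ := measure_mono hsub
    _ ≤ _ := measure_union_le _ _
    _ ≤ δ / 2 + δ / 2 := by
        refine add_le_add (hK n) ((measure_biUnion_finset_le _ _).trans (le_trans ?_ hn))
        exact Finset.sum_le_sum fun m _ => measure_union_le _ _
    _ = δ := ENNReal.add_halves δ

/-! ### Centred sums -/

/-- The centred and scaled sum `n^{-1/2} (∑_{t < n} g (X_t) - n ∫ g dν)`. -/
noncomputable def empProc {Ω : Type*} (ν : Measure ℝ) (X : ℕ → Ω → ℝ) (g : ℝ → ℝ) (n : ℕ)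
    (ω : Ω) : ℝ :=
  (√n)⁻¹ * (∑ t ∈ Finset.range n, g (X t ω) - n * ∫ x, g x ∂ν)

section

variable {Ω : Type*} {mΩ : MeasurableSpace Ω} {P : Measure Ω} [IsProbabilityMeasure P]
  {ν : Measure ℝ} {X : ℕ → Ω → ℝ}

lemma empProc_add {g h : ℝ → ℝ} (hg : Integrable g ν) (hh : Integrable h ν) (n : ℕ) (ω : Ω) :
    empProc ν X (fun x => g x + h x) n ω = empProc ν X g n ω + empProc ν X h n ω := by
  simp only [empProc, Finset.sum_add_distrib, integral_add hg hh]
  ring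

lemma empProc_sub {g h : ℝ → ℝ} (hg : Integrable g ν) (hh : Integrable h ν) (n : ℕ) (ω : Ω) :
    empProc ν X (fun x => g x - h x) n ω = empProc ν X g n ω - empProc ν X h n ω := by
  simp only [empProc, Finset.sum_sub_distrib, integral_sub hg hh]
  ring

lemma empProc_const_mul (g : ℝ → ℝ) (c : ℝ) (n : ℕ) (ω : Ω) :
    empProc ν X (fun x => c * g x) n ω = c * empProc ν X g n ω := by
  simp only [empProc, ← Finset.mul_sum, integral_const_mul]
  ring

/-- Chebyshev's inequality for centred sums. -/
theorem measure_le_abs_empProc (hlaw : ∀ t, HasLaw (X t) ν P)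
    (hind : iIndepFun X P) {g : ℝ → ℝ} (hg : Measurable g) (hg2 : MemLp g 2 ν) (n : ℕ) {c : ℝ}
    (hc : 0 < c) : P {ω | c ≤ |empProc ν X g n ω|} ≤ ENNReal.ofReal (Var[g; ν] / c ^ 2) := by
  -- For `n = 0` the factor `(√0)⁻¹` is `0`, so the event is empty.
  rcases Nat.eq_zero_or_pos n with rfl | hn
  · simp [empProc, hc.not_ge]
  have hν : IsProbabilityMeasure ν := by
    rw [← (hlaw 0).map_eq]; exact Measure.isProbabilityMeasure_map (hlaw 0).aemeasurable
  have hmem : ∀ t, MemLp (fun ω => g (X t ω)) 2 P := fun t => by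
    have := (hlaw t).map_eq ▸ hg2
    exact (memLp_map_measure_iff (by rw [(hlaw t).map_eq]; exact hg2.1)
      (hlaw t).aemeasurable).1 this
  have hint : ∀ t, ∫ ω, g (X t ω) ∂P = ∫ x, g x ∂ν := fun t => by
    rw [← (hlaw t).map_eq, integral_map (hlaw t).aemeasurable hg.aestronglyMeasurable]
  have hvar : ∀ t, Var[fun ω => g (X t ω); P] = Var[g; ν] := fun t => by
    rw [← (hlaw t).map_eq, variance_map hg.aemeasurable (hlaw t).aemeasurable]
    rfl
  set S : Ω → ℝ := fun ω => (√n)⁻¹ * ∑ t ∈ Finset.range n, g (X t ω) with hS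
  have hSmem : MemLp S 2 P := (memLp_finsetSum _ fun t _ => hmem t).const_mul _
  have hSint : ∫ ω, S ω ∂P = (√n)⁻¹ * (n * ∫ x, g x ∂ν) := by
    rw [hS, integral_const_mul, integral_finsetSum _ fun t _ => (hmem t).integrable (by norm_num)]
    simp [hint]
  have hSvar : Var[S; P] = Var[g; ν] := by
    have hsum : Var[∑ t ∈ Finset.range n, fun ω => g (X t ω); P] = n * Var[g; ν] := by
      rw [IndepFun.variance_sum (fun t _ => hmem t)]
      · simp [hvar]
      · intro i _ j _ hij
        exact (hind.indepFun hij).comp hg hg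
    have : S = fun ω => (√n)⁻¹ * (∑ t ∈ Finset.range n, fun ω => g (X t ω)) ω := by
      ext ω; simp [hS]
    rw [this, variance_const_mul, hsum, inv_pow, Real.sq_sqrt (by positivity)]
    field_simp
  have := meas_ge_le_variance_div_sq hSmem hc
  rw [hSvar, hSint] at this
  refine le_of_eq_of_le ?_ this
  congr 1; ext ω
  simp only [empProc, hS, Set.mem_ofPred_eq, mul_sub]

end

/-! ### The Bahadur representation of a sample quantile -/

/-- The indicator function of `(-∞, u]`. -/
noncomputable def indIic (u : ℝ) : ℝ → ℝ := (Set.Iic u).indicator (fun _ => (1 : ℝ))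

lemma measurable_indIic (u : ℝ) : Measurable (indIic u) :=
  measurable_const.indicator measurableSet_Iic

lemma memLp_indIic (u : ℝ) (ν : Measure ℝ) [IsFiniteMeasure ν] : MemLp (indIic u) 2 ν :=
  (memLp_const (1 : ℝ)).indicator measurableSet_Iic

lemma integrable_indIic (u : ℝ) (ν : Measure ℝ) [IsFiniteMeasure ν] : Integrable (indIic u) ν :=
  (memLp_indIic u ν).integrable (by norm_num)

lemma integral_indIic (u : ℝ) (ν : Measure ℝ) : ∫ x, indIic u x ∂ν = ν.real (Set.Iic u) := by
  rw [indIic, integral_indicator_const _ measurableSet_Iic, smul_eq_mul, mul_one]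

lemma indIic_mul_indIic (u v : ℝ) (x : ℝ) : indIic u x * indIic v x = indIic (min u v) x := by
  simp only [indIic, Set.indicator_apply, Set.mem_Iic, le_min_iff]
  split_ifs <;> simp_all

lemma variance_indIic_le_one (u : ℝ) (ν : Measure ℝ) [IsProbabilityMeasure ν] :
    Var[indIic u; ν] ≤ 1 := by
  refine (variance_le_expectation_sq (measurable_indIic u).aestronglyMeasurable).trans ?_
  have : (indIic u ^ 2 : ℝ → ℝ) = indIic u := by
    ext x; rw [Pi.pow_apply, sq, indIic_mul_indIic, min_self]
  rw [this, integral_indIic]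
  exact measureReal_le_one

/-- The squared difference is the indicator of the interval between `u` and `v`, and the second
moment bounds the variance. This makes increments of the empirical process small near a continuity
point. -/
lemma variance_indIic_sub_le (u v : ℝ) (ν : Measure ℝ) [IsProbabilityMeasure ν] :
    Var[indIic u - indIic v; ν] ≤ |ν.real (Set.Iic u) - ν.real (Set.Iic v)| := by
  refine (variance_le_expectation_sq
    ((measurable_indIic u).sub (measurable_indIic v)).aestronglyMeasurable).trans (le_of_eq ?_)
  have hsq : ((indIic u - indIic v) ^ 2 : ℝ → ℝ)
      = fun x => indIic u x + indIic v x - 2 * indIic (min u v) x := by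
    ext x
    have h1 := indIic_mul_indIic u u x
    have h2 := indIic_mul_indIic v v x
    have h3 := indIic_mul_indIic u v x
    rw [min_self] at h1 h2
    simp only [Pi.pow_apply, Pi.sub_apply]
    linear_combination h1 + h2 - 2 * h3
  have hmono : ∀ {a b : ℝ}, a ≤ b → ν.real (Set.Iic a) ≤ ν.real (Set.Iic b) := fun h =>
    measureReal_mono (Set.Iic_subset_Iic.2 h)
  have hi := fun u => integrable_indIic u ν
  have hadd : Integrable (fun x => indIic u x + indIic v x) ν := (hi u).add (hi v)
  simp only [hsq]
  rw [integral_sub hadd ((hi _).const_mul _), integral_add (hi u) (hi v),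
    integral_const_mul, integral_indIic, integral_indIic, integral_indIic]
  rcases le_total u v with h | h
  · rw [min_eq_left h, abs_of_nonpos (sub_nonpos.2 (hmono h))]; ring
  · rw [min_eq_right h, abs_of_nonneg (sub_nonneg.2 (hmono h))]; ring

/-- Counting duality, centred and scaled: at least `k` observations must lie in `(-∞, u]`. The
empirical process is random, the right side a deterministic threshold. -/
lemma orderStat_le_iff_empProc {Ω : Type*} {ν : Measure ℝ} {X : ℕ → Ω → ℝ}
    {n k : ℕ} (hk : 1 ≤ k) (hkn : k ≤ n) (u : ℝ) (ω : Ω) :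
    orderStat (fun t : Fin n => X t ω) k ≤ u ↔
      -empProc ν X (indIic u) n ω ≤ (√n)⁻¹ * (n * ν.real (Set.Iic u) - k) := by
  have hn : 0 < (√n)⁻¹ := by
    have : 0 < n := by omega
    positivity
  rw [orderStat_le_iff _ hk hkn, empProc, integral_indIic, ← mul_neg, mul_le_mul_iff_right₀ hn]
  have : ∑ t ∈ Finset.range n, indIic u (X t ω)
      = ((Finset.univ.filter (fun t : Fin n => X t ω ≤ u)).card : ℝ) := by
    rw [Finset.sum_range, Finset.card_filter]
    push_cast
    simp [indIic, Set.indicator_apply]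
  rw [this, ← Nat.cast_le (α := ℝ)]
  constructor <;> intro h <;> linarith

lemma eventually_one_le_floor_mul {q : ℝ} (hq : 0 < q) :
    ∀ᶠ n : ℕ in atTop, 1 ≤ ⌊(n : ℝ) * q⌋₊ := by
  filter_upwards [eventually_ge_atTop ⌈1 / q⌉₊] with n hn
  rw [Nat.one_le_floor_iff, ← div_le_iff₀ hq]
  exact (Nat.le_ceil _).trans (by exact_mod_cast hn)

lemma tendsto_div_sqrt_natCast (y : ℝ) : Tendsto (fun n : ℕ => y / √(n : ℝ)) atTop (𝓝 0) :=
  tendsto_const_nhds.div_atTop (Real.tendsto_sqrt_atTop.comp tendsto_natCast_atTop_atTop)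

/-- The thresholds to which the centred empirical distribution function is compared converge. -/
lemma tendsto_scaled_increment {F : ℝ → ℝ} {ξ f q : ℝ} (hq : 0 ≤ q) (hFξ : F ξ = q)
    (hd : HasDerivAt F f ξ) (y : ℝ) :
    Tendsto (fun n : ℕ => (√n)⁻¹ * (n * F (ξ + y / √n) - ⌊(n : ℝ) * q⌋₊)) atTop (𝓝 (f * y)) := by
  have h1 : Tendsto (fun n : ℕ => √(n : ℝ) * (F (ξ + y / √n) - F ξ)) atTop (𝓝 (f * y)) := by
    rcases eq_or_ne y 0 with rfl | hy
    · simp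
    have hs := (hasDerivAt_iff_tendsto_slope_zero.1 hd)
    have hz : Tendsto (fun n : ℕ => y / √(n : ℝ)) atTop (𝓝[≠] 0) := by
      refine tendsto_nhdsWithin_iff.2 ⟨tendsto_div_sqrt_natCast y, ?_⟩
      filter_upwards [eventually_gt_atTop 0] with n hn
      have : (0 : ℝ) < √n := by positivity
      exact div_ne_zero hy this.ne'
    refine ((hs.comp hz).mul_const y).congr' ?_
    filter_upwards [eventually_gt_atTop 0] with n hn
    have : (0 : ℝ) < √n := by positivity
    simp only [Function.comp_apply, smul_eq_mul]
    field_simp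
  -- Rounding `nq` down costs less than `1`, which is negligible against `√n`.
  have h2 : Tendsto (fun n : ℕ => (√(n : ℝ))⁻¹ * (n * q - ⌊(n : ℝ) * q⌋₊)) atTop (𝓝 0) := by
    refine tendsto_of_tendsto_of_tendsto_of_le_of_le tendsto_const_nhds
      (tendsto_div_sqrt_natCast 1) (fun n => ?_) (fun n => ?_)
    · exact mul_nonneg (by positivity) (sub_nonneg.2 (Nat.floor_le (by positivity)))
    · simp only [one_div]
      refine mul_le_of_le_one_right (by positivity) ?_
      linarith [Nat.lt_floor_add_one ((n : ℝ) * q)]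
  refine ((h1.add h2).congr' ?_).trans (by simp)
  filter_upwards [eventually_gt_atTop 0] with n hn
  have : (0 : ℝ) < √n := by positivity
  have hs : √(n : ℝ) * √n = n := Real.mul_self_sqrt (by positivity)
  rw [hFξ]
  field_simp
  rw [show √(n : ℝ) ^ 2 = n by rw [sq, hs]]
  ring

section

variable {Ω : Type*} {mΩ : MeasurableSpace Ω} {P : Measure Ω} [IsProbabilityMeasure P]
  {ν : Measure ℝ} [IsProbabilityMeasure ν] {X : ℕ → Ω → ℝ}

/-- Asymptotic equicontinuity of the empirical process at a continuity point of the distribution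
function. -/
theorem tendsto_measure_empProc_indIic_sub (hlaw : ∀ t, HasLaw (X t) ν P) (hind : iIndepFun X P)
    {ξ : ℝ} (hF : ContinuousAt (fun x => ν.real (Set.Iic x)) ξ) {u : ℕ → ℝ}
    (hu : Tendsto u atTop (𝓝 ξ)) {c : ℝ} (hc : 0 < c) :
    Tendsto (fun n => P {ω | c ≤ |empProc ν X (indIic (u n)) n ω - empProc ν X (indIic ξ) n ω|})
      atTop (𝓝 0) := by
  have hlim : Tendsto (fun n => ENNReal.ofReal
      (|ν.real (Set.Iic (u n)) - ν.real (Set.Iic ξ)| / c ^ 2)) atTop (𝓝 0) := by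
    have h1 := (((hF.tendsto.comp hu).sub_const (ν.real (Set.Iic ξ))).abs.div_const (c ^ 2))
    simpa using ENNReal.tendsto_ofReal h1
  refine tendsto_of_tendsto_of_tendsto_of_le_of_le tendsto_const_nhds hlim (fun _ => zero_le)
    fun n => ?_
  have := measure_le_abs_empProc hlaw hind ((measurable_indIic (u n)).sub (measurable_indIic ξ))
    ((memLp_indIic (u n) ν).sub (memLp_indIic ξ ν)) n hc
  refine le_trans (le_of_eq ?_) (this.trans (ENNReal.ofReal_le_ofReal ?_))
  · congr 1; ext ω
    rw [Set.mem_ofPred_eq, ← empProc_sub (integrable_indIic _ ν) (integrable_indIic _ ν)]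
    rfl
  · gcongr
    exact variance_indIic_sub_le _ _ _

/-- **Bahadur representation**: a sample quantile is, up to an error that is negligible in
probability at the scale `n^{-1/2}`, a linear function of the empirical distribution function. -/
theorem tendstoInMeasure_sampleQuantile (hlaw : ∀ t, HasLaw (X t) ν P) (hind : iIndepFun X P)
    {ξ f q : ℝ} (hq : q ∈ Set.Ioo (0 : ℝ) 1) (hf : 0 < f) (hFξ : ν.real (Set.Iic ξ) = q)
    (hd : HasDerivAt (fun x => ν.real (Set.Iic x)) f ξ) :
    TendstoInMeasure P ((fun (n : ℕ) ω => √n * (sampleQuantile (fun t : Fin n => X t ω) q - ξ))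
      - fun n ω => -f⁻¹ * empProc ν X (indIic ξ) n ω) atTop 0 := by
  have hlim := tendsto_scaled_increment hq.1.le hFξ hd
  have hu : ∀ y : ℝ, Tendsto (fun n : ℕ => ξ + y / √(n : ℝ)) atTop (𝓝 ξ) := fun y => by
    simpa using (tendsto_div_sqrt_natCast y).const_add ξ
  have hiff : ∀ᶠ n : ℕ in atTop, ∀ (y : ℝ) (ω : Ω),
      √n * (sampleQuantile (fun t : Fin n => X t ω) q - ξ) ≤ y ↔
        -empProc ν X (indIic (ξ + y / √n)) n ω ≤
          (√n)⁻¹ * (n * ν.real (Set.Iic (ξ + y / √n)) - ⌊(n : ℝ) * q⌋₊) := by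
    filter_upwards [eventually_one_le_floor_mul hq.1, eventually_gt_atTop 0] with n hk hn y ω
    have hkn : ⌊(n : ℝ) * q⌋₊ ≤ n := by
      refine Nat.floor_le_of_le ?_
      exact mul_le_of_le_one_right (by positivity) hq.2.le
    have hs : (0 : ℝ) < √n := by positivity
    rw [← orderStat_le_iff_empProc hk hkn, ← le_div_iff₀' hs, sub_le_iff_le_add', sampleQuantile]
  refine tendstoInMeasure_sub_of_tight (fun δ hδ => ?_) (fun y ε hε => ?_) (fun y ε hε => ?_)
  -- Tightness of the linear term: Chebyshev with a variance at most `1`, uniformly in `n`.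
  · have hT : Tendsto (fun K : ℝ => ENNReal.ofReal (1 / K ^ 2)) atTop (𝓝 0) := by
      have : Tendsto (fun K : ℝ => 1 / K ^ 2) atTop (𝓝 0) :=
        tendsto_const_nhds.div_atTop (tendsto_pow_atTop (by norm_num))
      simpa using ENNReal.tendsto_ofReal this
    obtain ⟨K, hK, hK0⟩ := ((ENNReal.tendsto_nhds_zero.1 hT δ hδ).and
      (eventually_gt_atTop 0)).exists
    refine ⟨f⁻¹ * K, fun n => le_trans (le_of_eq ?_) ((measure_le_abs_empProc hlaw hind
      (measurable_indIic ξ) (memLp_indIic ξ ν) n hK0).trans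
        ((ENNReal.ofReal_le_ofReal ?_).trans hK))⟩
    · congr 1; ext ω
      simp only [Set.mem_ofPred_eq, abs_mul, abs_neg, abs_of_pos (inv_pos.2 hf)]
      rw [mul_le_mul_iff_right₀ (inv_pos.2 hf)]
    · gcongr
      exact variance_indIic_le_one ξ ν
  -- With `u_n = ξ + y / √n`, the event forces the negated process to be at most `fy + fε/2` at
  -- `u_n` and at least `fy + fε` at `ξ`: a gap of `fε/2`, excluded by equicontinuity.
  · refine tendsto_of_tendsto_of_tendsto_of_le_of_le' tendsto_const_nhds
      (tendsto_measure_empProc_indIic_sub hlaw hind hd.continuousAt (hu y)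
        (c := f * ε / 2) (by positivity)) (Eventually.of_forall fun _ => zero_le) ?_
    filter_upwards [hiff, (hlim y).eventually_le_const (u := f * y + f * ε / 2)
      (by have := mul_pos hf hε; linarith)] with n hn hle
    refine measure_mono fun ω ⟨h1, h2⟩ => ?_
    rw [hn] at h1
    rw [neg_mul, ← mul_neg, le_inv_mul_iff₀ hf] at h2
    simp only [Set.mem_ofPred_eq]
    refine le_trans ?_ (le_abs_self _)
    nlinarith
  -- The intermediate level `y + ε/2` turns `y + ε ≤ V` into the failure of an inequality covered by
  -- `hiff`. Its threshold tends to `fy + fε/2`, hence is eventually at least `fy + fε/4`, while the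
  -- negated process at `ξ` is at most `fy`.
  · refine tendsto_of_tendsto_of_tendsto_of_le_of_le' tendsto_const_nhds
      (tendsto_measure_empProc_indIic_sub hlaw hind hd.continuousAt (hu (y + ε / 2))
        (c := f * ε / 4) (by positivity)) (Eventually.of_forall fun _ => zero_le) ?_
    filter_upwards [hiff, (hlim (y + ε / 2)).eventually_const_le (u := f * y + f * ε / 4)
      (by have := mul_pos hf hε; linarith)] with n hn hle
    refine measure_mono fun ω ⟨h1, h2⟩ => ?_
    have h3 : ¬ √n * (sampleQuantile (fun t : Fin n => X t ω) q - ξ) ≤ y + ε / 2 := by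
      push Not; linarith
    rw [hn, not_le] at h3
    rw [neg_mul, ← mul_neg, inv_mul_le_iff₀ hf] at h1
    simp only [Set.mem_ofPred_eq]
    refine le_trans ?_ (neg_le_abs _)
    nlinarith

end

/-! ### The general trimean of an exponential sample -/

lemma tendstoInMeasure_zero_add {Ω : Type*} {mΩ : MeasurableSpace Ω} {P : Measure Ω}
    {U V : ℕ → Ω → ℝ} (hU : TendstoInMeasure P U atTop 0) (hV : TendstoInMeasure P V atTop 0) :
    TendstoInMeasure P (U + V) atTop 0 := by
  rw [tendstoInMeasure_iff_norm] at *
  intro ε hε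
  have h := (hU (ε / 2) (half_pos hε)).add (hV (ε / 2) (half_pos hε))
  rw [add_zero] at h
  refine tendsto_of_tendsto_of_tendsto_of_le_of_le tendsto_const_nhds h (fun _ => zero_le)
    fun n => le_trans (measure_mono fun ω hω => ?_) (measure_union_le _ _)
  simp only [Pi.add_apply, Pi.zero_apply, sub_zero, Real.norm_eq_abs, Set.mem_ofPred_eq,
    Set.mem_union] at *
  by_contra! hlt
  linarith [abs_add_le (U n ω) (V n ω)]

lemma tendstoInMeasure_zero_const_mul {Ω : Type*} {mΩ : MeasurableSpace Ω} {P : Measure Ω}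
    {U : ℕ → Ω → ℝ} (c : ℝ) (hU : TendstoInMeasure P U atTop 0) :
    TendstoInMeasure P (fun n ω => c * U n ω) atTop 0 := by
  rw [tendstoInMeasure_iff_norm] at *
  intro ε hε
  refine tendsto_of_tendsto_of_tendsto_of_le_of_le tendsto_const_nhds
    (hU (ε / (|c| + 1)) (by positivity)) (fun _ => zero_le)
    fun n => measure_mono fun ω hω => ?_
  simp only [Pi.zero_apply, sub_zero, Real.norm_eq_abs, Set.mem_ofPred_eq, abs_mul] at *
  rw [div_le_iff₀ (by positivity)]
  nlinarith [abs_nonneg (U n ω)]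

/-- For nested half-lines a product of two indicators is the indicator of the smaller one, so the
square is again a combination of the same three indicators. -/
lemma variance_three_indIic {ν : Measure ℝ} [IsProbabilityMeasure ν] {u v w : ℝ} (huv : u ≤ v)
    (hvw : v ≤ w) (a b c : ℝ) :
    Var[fun x => a * indIic u x + b * indIic v x + c * indIic w x; ν]
      = (a ^ 2 + 2 * a * b + 2 * a * c) * ν.real (Set.Iic u)
        + (b ^ 2 + 2 * b * c) * ν.real (Set.Iic v) + c ^ 2 * ν.real (Set.Iic w)
        - (a * ν.real (Set.Iic u) + b * ν.real (Set.Iic v) + c * ν.real (Set.Iic w)) ^ 2 := by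
  have hint : ∀ a b c : ℝ, ∫ x, (a * indIic u x + b * indIic v x + c * indIic w x) ∂ν
      = a * ν.real (Set.Iic u) + b * ν.real (Set.Iic v) + c * ν.real (Set.Iic w) := by
    intro a b c
    have h1 := (integrable_indIic u ν).const_mul a
    have h2 := (integrable_indIic v ν).const_mul b
    have h3 := (integrable_indIic w ν).const_mul c
    have h12 : Integrable (fun x => a * indIic u x + b * indIic v x) ν := h1.add h2
    rw [integral_add h12 h3, integral_add h1 h2]
    simp only [integral_const_mul, integral_indIic]
  have hmem : MemLp (fun x => a * indIic u x + b * indIic v x + c * indIic w x) 2 ν :=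
    (((memLp_indIic u ν).const_mul a).add ((memLp_indIic v ν).const_mul b)).add
      ((memLp_indIic w ν).const_mul c)
  rw [variance_eq_sub hmem, hint, ← hint (a ^ 2 + 2 * a * b + 2 * a * c)]
  refine congrArg (· - _) (integral_congr_ae (Eventually.of_forall fun x => ?_))
  have huu := indIic_mul_indIic u u x
  have hvv := indIic_mul_indIic v v x
  have hww := indIic_mul_indIic w w x
  have h1 := indIic_mul_indIic u v x
  have h2 := indIic_mul_indIic u w x
  have h3 := indIic_mul_indIic v w x
  rw [min_self] at huu hvv hww
  rw [min_eq_left huv] at h1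
  rw [min_eq_left (huv.trans hvw)] at h2
  rw [min_eq_left hvw] at h3
  simp only [Pi.pow_apply]
  linear_combination a ^ 2 * huu + b ^ 2 * hvv + c ^ 2 * hww + 2 * a * b * h1 + 2 * a * c * h2
    + 2 * b * c * h3

/-- The `q`-th quantile of the exponential distribution with mean `l`. -/
noncomputable def expQuantile (l q : ℝ) : ℝ := -l * Real.log (1 - q)

lemma expQuantile_pos {l q : ℝ} (hl : 0 < l) (hq : q ∈ Set.Ioo (0 : ℝ) 1) :
    0 < expQuantile l q := by
  have := Real.log_neg (x := 1 - q) (by linarith [hq.2]) (by linarith [hq.1])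
  rw [expQuantile]
  nlinarith

lemma expQuantile_mono {l q r : ℝ} (hl : 0 < l) (hr : r < 1) (hqr : q ≤ r) :
    expQuantile l q ≤ expQuantile l r := by
  have := Real.log_le_log (x := 1 - r) (y := 1 - q) (by linarith) (by linarith)
  simp only [expQuantile]
  nlinarith

lemma measureReal_expMeasure_Iic {l x : ℝ} (hl : 0 < l) (hx : 0 ≤ x) :
    (expMeasure l⁻¹).real (Set.Iic x) = 1 - Real.exp (-(l⁻¹ * x)) := by
  have := isProbabilityMeasure_expMeasure (inv_pos.2 hl)
  rw [← cdf_eq_real, cdf_expMeasure_eq (inv_pos.2 hl), if_pos hx]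

lemma exp_expQuantile {l q : ℝ} (hl : 0 < l) (hq : q < 1) :
    Real.exp (-(l⁻¹ * expQuantile l q)) = 1 - q := by
  rw [expQuantile]
  have : -(l⁻¹ * (-l * Real.log (1 - q))) = Real.log (1 - q) := by field_simp
  rw [this, Real.exp_log (by linarith)]

lemma measureReal_expMeasure_expQuantile {l q : ℝ} (hl : 0 < l) (hq : q ∈ Set.Ioo (0 : ℝ) 1) :
    (expMeasure l⁻¹).real (Set.Iic (expQuantile l q)) = q := by
  rw [measureReal_expMeasure_Iic hl (expQuantile_pos hl hq).le, exp_expQuantile hl hq.2]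
  ring

lemma hasDerivAt_expMeasure_expQuantile {l q : ℝ} (hl : 0 < l) (hq : q ∈ Set.Ioo (0 : ℝ) 1) :
    HasDerivAt (fun x => (expMeasure l⁻¹).real (Set.Iic x)) ((1 - q) / l) (expQuantile l q) := by
  have h : HasDerivAt (fun x => 1 - Real.exp (-(l⁻¹ * x)))
      (-(Real.exp (-(l⁻¹ * expQuantile l q)) * -(l⁻¹ * 1))) (expQuantile l q) :=
    (((hasDerivAt_id _).const_mul l⁻¹).neg.exp).const_sub 1
  rw [exp_expQuantile hl hq.2] at h
  refine (h.congr_of_eventuallyEq ?_).congr_deriv (by field_simp)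
  filter_upwards [Ioi_mem_nhds (expQuantile_pos hl hq)] with x hx
  exact measureReal_expMeasure_Iic hl (le_of_lt hx)

/-- The centring constant is the trimean of the population quantiles. -/
lemma cCoef_mul_eq {α p l : ℝ} (hp : p ∈ Set.Ioo (0 : ℝ) (1 / 2)) :
    cCoef α p * l = α / 2 * expQuantile l p + (1 - α) * expQuantile l (1 / 2)
      + α / 2 * expQuantile l (1 - p) := by
  have hp0 := hp.1
  have hp1 : 0 < 1 - p := by linarith [hp.2]
  have h2 : Real.log (1 - 1 / 2) = -Real.log 2 := by
    rw [← Real.log_inv]; norm_num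
  simp only [cCoef, expQuantile, h2, sub_sub_cancel]
  rw [one_div (p * (1 - p)), Real.log_inv, Real.log_mul hp0.ne' hp1.ne']
  ring

/-- Asymptotic normality of the general trimean of an i.i.d. exponential sample. -/
theorem tendstoInDistribution_generalTrimean {Ω : Type*} {mΩ : MeasurableSpace Ω} {P : Measure Ω}
    [IsProbabilityMeasure P] {X : ℕ → Ω → ℝ} {l : ℝ} (hl : 0 < l) (hX : ∀ t, Measurable (X t))
    (hlaw : ∀ t, HasLaw (X t) (expMeasure l⁻¹) P) (hind : iIndepFun X P) (α : ℝ) {p : ℝ}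
    (hp : p ∈ Set.Ioo (0 : ℝ) (1 / 2)) :
    TendstoInDistribution (fun (n : ℕ) ω =>
        √n * (generalTrimean α p (fun t : Fin n => X t ω) - cCoef α p * l))
      atTop (id : ℝ → ℝ) (fun _ => P) (gaussianReal 0 (Real.toNNReal (fCoef α p * l ^ 2))) := by
  have := isProbabilityMeasure_expMeasure (inv_pos.2 hl)
  obtain ⟨hp0, hp2⟩ := hp
  set ν := expMeasure l⁻¹ with hν
  have hq1 : p ∈ Set.Ioo (0 : ℝ) 1 := ⟨hp0, by linarith⟩
  have hq2 : (1 / 2 : ℝ) ∈ Set.Ioo (0 : ℝ) 1 := by norm_num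
  have hq3 : 1 - p ∈ Set.Ioo (0 : ℝ) 1 := ⟨by linarith, by linarith⟩
  have hB : ∀ q ∈ Set.Ioo (0 : ℝ) 1, TendstoInMeasure P
      ((fun (n : ℕ) ω => √n * (sampleQuantile (fun t : Fin n => X t ω) q - expQuantile l q))
      - fun n ω => -((1 - q) / l)⁻¹ * empProc ν X (indIic (expQuantile l q)) n ω) atTop 0 :=
    fun q hq => tendstoInMeasure_sampleQuantile hlaw hind hq (div_pos (by linarith [hq.2]) hl)
      (measureReal_expMeasure_expQuantile hl hq) (hasDerivAt_expMeasure_expQuantile hl hq)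
  -- The trimean weight `a` times the Bahadur factor, minus the reciprocal of the density at the
  -- quantile. Thus `G` is the influence function of the trimean up to a constant.
  set b : ℝ → ℝ → ℝ := fun a q => a * -((1 - q) / l)⁻¹ with hb
  set G : ℝ → ℝ := fun x => b (α / 2) p * indIic (expQuantile l p) x
    + b (1 - α) (1 / 2) * indIic (expQuantile l (1 / 2)) x
    + b (α / 2) (1 - p) * indIic (expQuantile l (1 - p)) x with hG
  have hGm : Measurable G :=
    (((measurable_indIic _).const_mul _).add ((measurable_indIic _).const_mul _)).add
      ((measurable_indIic _).const_mul _)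
  have hGmem : MemLp G 2 ν :=
    (((memLp_indIic _ ν).const_mul _).add ((memLp_indIic _ ν).const_mul _)).add
      ((memLp_indIic _ ν).const_mul _)
  have hGvar : Var[G; ν] = fCoef α p * l ^ 2 := by
    rw [hG, variance_three_indIic (expQuantile_mono hl (by norm_num) hp2.le)
      (expQuantile_mono hl (by linarith) (by linarith)),
      measureReal_expMeasure_expQuantile hl hq1, measureReal_expMeasure_expQuantile hl hq2,
      measureReal_expMeasure_expQuantile hl hq3]
    have h1 : 1 - p ≠ 0 := by linarith
    simp only [hb, fCoef, sub_sub_cancel]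
    field_simp
    ring
  have hGemp : ∀ n ω, empProc ν X G n ω
      = b (α / 2) p * empProc ν X (indIic (expQuantile l p)) n ω
      + b (1 - α) (1 / 2) * empProc ν X (indIic (expQuantile l (1 / 2))) n ω
      + b (α / 2) (1 - p) * empProc ν X (indIic (expQuantile l (1 - p))) n ω := fun n ω => by
    have h1 := fun c q => (integrable_indIic (expQuantile l q) ν).const_mul c
    have h12 : Integrable (fun x => b (α / 2) p * indIic (expQuantile l p) x
        + b (1 - α) (1 / 2) * indIic (expQuantile l (1 / 2)) x) ν := (h1 _ _).add (h1 _ _)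
    rw [hG, empProc_add h12 (h1 _ _), empProc_add (h1 _ _) (h1 _ _), empProc_const_mul,
      empProc_const_mul, empProc_const_mul]
  have hclt : TendstoInDistribution (fun n ω => empProc ν X G n ω) atTop (id : ℝ → ℝ)
      (fun _ => P) (gaussianReal 0 (Real.toNNReal (fCoef α p * l ^ 2))) := by
    have hvar : Var[fun ω => G (X 0 ω); P] = fCoef α p * l ^ 2 := by
      rw [← hGvar, ← (hlaw 0).map_eq, variance_map hGm.aemeasurable (hX 0).aemeasurable]
      rfl
    have hint : ∫ ω, G (X 0 ω) ∂P = ∫ x, G x ∂ν := by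
      rw [← (hlaw 0).map_eq, integral_map (hX 0).aemeasurable hGm.aestronglyMeasurable]
    have hmem : MemLp (G ∘ X 0) 2 P :=
      (memLp_map_measure_iff (by rw [(hlaw 0).map_eq]; exact hGmem.1)
        (hX 0).aemeasurable).1 (by rw [(hlaw 0).map_eq]; exact hGmem)
    have h := tendstoInDistribution_inv_sqrt_mul_sum_sub (P := P)
      (P' := gaussianReal 0 (Real.toNNReal (fCoef α p * l ^ 2))) (X := fun t ω => G (X t ω))
      (Y := id) (by rw [hvar]; exact HasLaw.id) hmem (hind.comp (fun _ => G) fun _ => hGm)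
      (fun t => IdentDistrib.comp ⟨(hX t).aemeasurable, (hX 0).aemeasurable, by
        rw [(hlaw t).map_eq, (hlaw 0).map_eq]⟩ hGm)
    simp only [hint] at h
    exact h
  -- Slutsky: the three Bahadur remainders, with their weights, add up to the difference from the
  -- centred sum of `G`.
  refine tendstoInDistribution_of_tendstoInMeasure_sub _ _ hclt ?_ fun n => ?_
  · have h := tendstoInMeasure_zero_add (tendstoInMeasure_zero_add
      (tendstoInMeasure_zero_const_mul (α / 2) (hB _ hq1))
      (tendstoInMeasure_zero_const_mul (1 - α) (hB _ hq2)))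
      (tendstoInMeasure_zero_const_mul (α / 2) (hB _ hq3))
    convert h using 1
    ext n ω
    simp only [Pi.sub_apply, Pi.add_apply, hGemp, generalTrimean, cCoef_mul_eq ⟨hp0, hp2⟩, hb]
    ring
  · exact ((((measurable_generalTrimean n α p).comp
      (measurable_pi_lambda _ fun t => hX t)).sub_const _).const_mul _).aemeasurable

/-! ### The law of the mid-energies -/

/-- The radial factor of the planar Gaussian in polar coordinates; an antiderivative is `-exp (-r² /
(2v))`. -/
lemma lintegral_rayleigh {v : ℝ} (hv : 0 < v) {R : ℝ} (hR : 0 ≤ R) :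
    ∫⁻ r in Set.Ioc 0 R, ENNReal.ofReal (r / v * Real.exp (-(r ^ 2 / (2 * v))))
      = ENNReal.ofReal (1 - Real.exp (-(R ^ 2 / (2 * v)))) := by
  have hcont : Continuous fun r : ℝ => r / v * Real.exp (-(r ^ 2 / (2 * v))) := by fun_prop
  rw [← ofReal_integral_eq_lintegral_ofReal (hcont.integrableOn_Icc.mono_set
    Set.Ioc_subset_Icc_self), ← intervalIntegral.integral_of_le hR]
  · congr 1
    have hderiv : ∀ r : ℝ, HasDerivAt (fun r => -Real.exp (-(r ^ 2 / (2 * v))))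
        (r / v * Real.exp (-(r ^ 2 / (2 * v)))) r := fun r => by
      have h := (((hasDerivAt_pow 2 r).div_const (2 * v)).neg.exp).neg
      refine h.congr_deriv ?_
      field_simp
      norm_num
      ring
    rw [intervalIntegral.integral_eq_sub_of_hasDerivAt (fun r _ => hderiv r)
      (hcont.intervalIntegrable _ _)]
    simp
    ring
  · filter_upwards [ae_restrict_mem measurableSet_Ioc] with r hr
    have := hr.1
    positivity

lemma gaussianPDF_mul_gaussianPDF {v : NNReal} (x y : ℝ) :
    gaussianPDF 0 v x * gaussianPDF 0 v y
      = ENNReal.ofReal ((2 * Real.pi * v)⁻¹ * Real.exp (-((x ^ 2 + y ^ 2) / (2 * v)))) := by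
  rw [gaussianPDF, gaussianPDF, ← ENNReal.ofReal_mul (gaussianPDFReal_nonneg _ _ _)]
  congr 1
  simp only [gaussianPDFReal, sub_zero]
  have h : (√(2 * Real.pi * v))⁻¹ * (√(2 * Real.pi * v))⁻¹ = (2 * Real.pi * v)⁻¹ := by
    rw [← mul_inv, Real.mul_self_sqrt (by positivity)]
  rw [mul_mul_mul_comm, h, ← Real.exp_add]
  congr 2
  ring

lemma gaussian_prod_disc {v : NNReal} (hv : v ≠ 0) {c : ℝ} (hc : 0 ≤ c) :
    ((gaussianReal 0 v).prod (gaussianReal 0 v)) {z : ℝ × ℝ | (z.1 ^ 2 + z.2 ^ 2) / 2 ≤ c}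
      = ENNReal.ofReal (1 - Real.exp (-((v : ℝ)⁻¹ * c))) := by
  have hv0 : 0 < (v : ℝ) := by positivity
  have hS : MeasurableSet {z : ℝ × ℝ | (z.1 ^ 2 + z.2 ^ 2) / 2 ≤ c} :=
    measurableSet_le (by fun_prop) measurable_const
  set S : Set (ℝ × ℝ) := {z : ℝ × ℝ | (z.1 ^ 2 + z.2 ^ 2) / 2 ≤ c}
  have hR : √(2 * c) ^ 2 = 2 * c := Real.sq_sqrt (by positivity)
  -- The integrand in polar coordinates, Jacobian `r` included. It does not depend on the angle,
  -- whose integral `2π` cancels the constant `(2π)⁻¹`.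
  set Φ : ℝ → ENNReal := (Set.Ioc 0 √(2 * c)).indicator
    (fun r => ENNReal.ofReal (2 * Real.pi)⁻¹ *
      ENNReal.ofReal (r / v * Real.exp (-(r ^ 2 / (2 * v))))) with hΦ
  have hint : ∀ z : ℝ × ℝ, z ∈ polarCoord.target →
      ENNReal.ofReal z.1 • S.indicator (fun z => gaussianPDF 0 v z.1 * gaussianPDF 0 v z.2)
        (polarCoord.symm z)
      = Φ z.1 := by
    rintro ⟨r, θ⟩ ⟨hr, -⟩
    have hr0 : 0 < r := hr
    have hsq : (r * Real.cos θ) ^ 2 + (r * Real.sin θ) ^ 2 = r ^ 2 := by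
      linear_combination r ^ 2 * Real.cos_sq_add_sin_sq θ
    have hmem : (r * Real.cos θ, r * Real.sin θ) ∈ S ↔ r ∈ Set.Ioc 0 √(2 * c) := by
      simp only [S, Set.mem_ofPred_eq, hsq, Set.mem_Ioc, hr0, true_and]
      rw [Real.le_sqrt hr0.le (by positivity), div_le_iff₀ (by norm_num), mul_comm c]
    simp only [polarCoord_symm_apply, hΦ, Set.indicator_apply, hmem]
    split_ifs
    · rw [gaussianPDF_mul_gaussianPDF, hsq, smul_eq_mul, ← ENNReal.ofReal_mul hr0.le,
        ← ENNReal.ofReal_mul (by positivity)]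
      congr 1
      field_simp
    · simp
  rw [gaussianReal_of_var_ne_zero 0 hv, prod_withDensity (measurable_gaussianPDF 0 v)
    (measurable_gaussianPDF 0 v), withDensity_apply _ hS, ← lintegral_indicator hS,
    ← Measure.volume_eq_prod, ← lintegral_comp_polarCoord_symm,
    setLIntegral_congr_fun polarCoord.open_target.measurableSet hint]
  have htarget : (volume : Measure (ℝ × ℝ)).restrict polarCoord.target
      = (volume.restrict (Set.Ioi (0 : ℝ))).prod
        (volume.restrict (Set.Ioo (-Real.pi) Real.pi)) := by
    rw [Measure.prod_restrict]; rfl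
  have hmeas : Measurable Φ := Measurable.indicator (by fun_prop) measurableSet_Ioc
  rw [htarget, lintegral_prod (fun z : ℝ × ℝ => Φ z.1)
    (hmeas.comp measurable_fst).aemeasurable]
  simp only [lintegral_const, Measure.restrict_apply_univ, Real.volume_Ioo, sub_neg_eq_add]
  rw [lintegral_mul_const _ hmeas, hΦ, lintegral_indicator measurableSet_Ioc,
    Measure.restrict_restrict measurableSet_Ioc,
    Set.inter_eq_left.2 Set.Ioc_subset_Ioi_self, lintegral_const_mul _ (by fun_prop),
    lintegral_rayleigh hv0 (Real.sqrt_nonneg _), hR, mul_right_comm,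
    ← ENNReal.ofReal_mul (by positivity)]
  have h1 : (2 * Real.pi)⁻¹ * (Real.pi + Real.pi) = 1 := by
    have := Real.pi_pos
    field_simp
    norm_num
  rw [h1, ENNReal.ofReal_one, one_mul]
  congr 4
  field_simp

/-- Half the squared norm of a planar centred isotropic Gaussian vector is exponential. -/
theorem hasLaw_half_sq_add_sq {Ω : Type*} {mΩ : MeasurableSpace Ω} {P : Measure Ω}
    [IsProbabilityMeasure P] {X Y : Ω → ℝ} {v : NNReal} (hv : v ≠ 0)
    (hX : HasLaw X (gaussianReal 0 v) P) (hY : HasLaw Y (gaussianReal 0 v) P)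
    (hXY : IndepFun X Y P) :
    HasLaw (fun ω => (X ω ^ 2 + Y ω ^ 2) / 2) (expMeasure (v : ℝ)⁻¹) P := by
  have hv0 : 0 < (v : ℝ) := by positivity
  have := isProbabilityMeasure_expMeasure (inv_pos.2 hv0)
  have hX' := hX.aemeasurable
  have hY' := hY.aemeasurable
  have hm : AEMeasurable (fun ω => (X ω ^ 2 + Y ω ^ 2) / 2) P := by fun_prop
  refine ⟨hm, ?_⟩
  have hpm := Measure.isProbabilityMeasure_map hm
  refine Measure.ext_of_Iic _ _ fun c => ?_
  rw [← ofReal_cdf (expMeasure (v : ℝ)⁻¹), cdf_expMeasure_eq (inv_pos.2 hv0)]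
  have hg : Measurable fun z : ℝ × ℝ => (z.1 ^ 2 + z.2 ^ 2) / 2 := by fun_prop
  have hmap : P.map (fun ω => (X ω ^ 2 + Y ω ^ 2) / 2)
      = ((gaussianReal 0 v).prod (gaussianReal 0 v)).map
        fun z : ℝ × ℝ => (z.1 ^ 2 + z.2 ^ 2) / 2 := by
    have h := (indepFun_iff_map_prod_eq_prod_map_map hX' hY').1 hXY
    rw [hX.map_eq, hY.map_eq] at h
    rw [← h, AEMeasurable.map_map_of_aemeasurable hg.aemeasurable (hX'.prodMk hY')]
    rfl
  rw [hmap, Measure.map_apply hg measurableSet_Iic]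
  split_ifs with hc
  · exact gaussian_prod_disc hv hc
  · have : (fun z : ℝ × ℝ => (z.1 ^ 2 + z.2 ^ 2) / 2) ⁻¹' Set.Iic c = ∅ := by
      ext z
      simp only [Set.mem_preimage, Set.mem_Iic, Set.mem_empty_iff_false, iff_false]
      have := sq_nonneg z.1
      have := sq_nonneg z.2
      intro h
      linarith
    simp [this]

/-! ### Arrays of samples on varying probability spaces -/

/-- Asymptotic normality of the general trimean for a triangular array whose rows are i.i.d.
exponential samples, each row living on its own probability space. -/
theorem tendstoInDistribution_generalTrimean_array {Ω : ℕ → Type*} [∀ n, MeasurableSpace (Ω n)]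
    {P : ∀ n, Measure (Ω n)} [∀ n, IsProbabilityMeasure (P n)] {Y : ∀ n, Fin n → Ω n → ℝ} {l : ℝ}
    (hl : 0 < l) (hlaw : ∀ n t, HasLaw (Y n t) (expMeasure l⁻¹) (P n))
    (hind : ∀ n, iIndepFun (Y n) (P n)) (α : ℝ) {p : ℝ} (hp : p ∈ Set.Ioo (0 : ℝ) (1 / 2)) :
    TendstoInDistribution (fun (n : ℕ) (ω : Ω n) =>
        √n * (generalTrimean α p (fun t => Y n t ω) - cCoef α p * l))
      atTop (id : ℝ → ℝ) P (gaussianReal 0 (Real.toNNReal (fCoef α p * l ^ 2))) := by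
  have := isProbabilityMeasure_expMeasure (inv_pos.2 hl)
  -- Convergence in distribution sees only the law of each row. Row `n` has the law of the first `n`
  -- terms of one i.i.d. sequence, to which the previous theorem applies.
  obtain ⟨Ω', _, Q, X, hX, hXlaw, hXind, hQ⟩ := exists_iid ℕ (expMeasure l⁻¹)
  have h := tendstoInDistribution_generalTrimean hl hX hXlaw hXind α hp
  have hYm : ∀ n, AEMeasurable (fun ω t => Y n t ω) (P n) := fun n =>
    aemeasurable_pi_lambda _ fun t => (hlaw n t).aemeasurable
  have hXm : ∀ n : ℕ, Measurable (fun ω (t : Fin n) => X t ω) := fun n =>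
    measurable_pi_lambda _ fun t => hX t
  have hrow : ∀ n : ℕ, (P n).map (fun ω t => Y n t ω) = Q.map (fun ω (t : Fin n) => X t ω) := by
    intro n
    rw [(iIndepFun_iff_map_fun_eq_pi_map fun t => (hlaw n t).aemeasurable).1 (hind n),
      (iIndepFun_iff_map_fun_eq_pi_map fun t : Fin n => (hX t).aemeasurable).1
        (hXind.precomp Fin.val_injective)]
    simp only [(hlaw n _).map_eq, (hXlaw _).map_eq]
  have hg : ∀ n : ℕ, Measurable fun x : Fin n → ℝ =>
      √n * (generalTrimean α p x - cCoef α p * l) := fun n =>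
    ((measurable_generalTrimean n α p).sub_const _).const_mul _
  refine ⟨fun n => (hg n).comp_aemeasurable (hYm n), aemeasurable_id, ?_⟩
  refine h.tendsto.congr fun n => Subtype.ext ?_
  have h1 := AEMeasurable.map_map_of_aemeasurable (hg n).aemeasurable (hYm n)
  have h2 := Measure.map_map (μ := Q) (hg n) (hXm n)
  rw [hrow, h2] at h1
  exact h1

/-- The filter of sets whose complements have vanishing probability along a sequence of
probability spaces. Convergence along it is convergence in probability. -/
def inProb {Ω : ℕ → Type*} [∀ n, MeasurableSpace (Ω n)] (P : ∀ n, Measure (Ω n)) :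
    Filter (Σ n, Ω n) where
  sets := {A | Tendsto (fun n => P n {ω | (⟨n, ω⟩ : Σ n, Ω n) ∉ A}) atTop (𝓝 0)}
  univ_sets := by simp
  sets_of_superset := fun {A B} hA hAB =>
    tendsto_of_tendsto_of_tendsto_of_le_of_le tendsto_const_nhds hA (fun _ => zero_le)
      fun n => measure_mono fun ω hω h => hω (hAB h)
  inter_sets := fun {A B} hA hB => by
    have h := Tendsto.add hA hB
    rw [add_zero] at h
    refine tendsto_of_tendsto_of_tendsto_of_le_of_le tendsto_const_nhds h (fun _ => zero_le)
      fun n => le_trans (measure_mono fun ω hω => ?_) (measure_union_le _ _)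
    exact not_and_or.1 hω

/-- With convergence in probability expressed by a filter, the continuous mapping theorem becomes
the ordinary calculus of limits. -/
lemma tendsto_inProb_iff {Ω : ℕ → Type*} [∀ n, MeasurableSpace (Ω n)] {P : ∀ n, Measure (Ω n)}
    {Z : ∀ n, Ω n → ℝ} {c : ℝ} :
    Tendsto (fun x : Σ n, Ω n => Z x.1 x.2) (inProb P) (𝓝 c) ↔
      ∀ ε : ℝ, 0 < ε → Tendsto (fun n => P n {ω | ε ≤ |Z n ω - c|}) atTop (𝓝 0) := by
  rw [Metric.tendsto_nhds]
  refine forall₂_congr fun ε _ => ?_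
  have : ∀ n, {ω | ε ≤ |Z n ω - c|}
      = {ω | (⟨n, ω⟩ : Σ n, Ω n) ∉ {x : Σ n, Ω n | dist (Z x.1 x.2) c < ε}} := fun n => by
    ext ω
    simp [Real.dist_eq]
  simp only [this]
  rfl

/-- An estimator that is asymptotically distributed at the scale `n^{-1/2}` is consistent. -/
theorem tendsto_inProb_of_tendstoInDistribution {Ω : ℕ → Type*} [∀ n, MeasurableSpace (Ω n)]
    {P : ∀ n, Measure (Ω n)} [∀ n, IsProbabilityMeasure (P n)] {T : ∀ n, Ω n → ℝ} {m : ℝ}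
    {γ : Measure ℝ} [IsProbabilityMeasure γ]
    (h : TendstoInDistribution (fun (n : ℕ) (ω : Ω n) => √n * (T n ω - m)) atTop (id : ℝ → ℝ) P γ) :
    Tendsto (fun x : Σ n, Ω n => T x.1 x.2) (inProb P) (𝓝 m) := by
  rw [tendsto_inProb_iff]
  intro ε hε
  rw [ENNReal.tendsto_nhds_zero]
  intro δ hδ
  -- Tightness gives only a weak inequality; the limsup argument below needs a strict one.
  obtain ⟨δ', hδ'0, hδ'⟩ := exists_between hδ
  obtain ⟨C, hC, hCγ⟩ := isTightMeasureSet_iff_exists_isCompact_measure_compl_le.1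
    (isTightMeasureSet_singleton (μ := γ)) δ' hδ'0
  obtain ⟨K, hK⟩ := hC.isBounded.exists_norm_le
  have hclosed : IsClosed {x : ℝ | K + 1 ≤ |x|} := isClosed_le continuous_const continuous_abs
  have hγ : γ {x : ℝ | K + 1 ≤ |x|} < δ := by
    refine lt_of_le_of_lt ((measure_mono fun x hx hxC => ?_).trans (hCγ γ rfl)) hδ'
    have h1 := hK x hxC
    rw [Real.norm_eq_abs] at h1
    have h2 : K + 1 ≤ |x| := hx
    linarith
  -- Portmanteau on the closed tail `K + 1 ≤ |x|`; an error of `ε` in `T` lands in this tail once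
  -- `√n ε ≥ K + 1`.
  have hlim := ProbabilityMeasure.limsup_measure_closed_le_of_tendsto h.tendsto hclosed
  simp only [ProbabilityMeasure.coe_mk, Measure.map_id] at hlim
  have hev := Filter.eventually_lt_of_limsup_lt (hlim.trans_lt hγ)
  have hs : Tendsto (fun n : ℕ => √(n : ℝ) * ε) atTop atTop :=
    (Real.tendsto_sqrt_atTop.comp tendsto_natCast_atTop_atTop).atTop_mul_const hε
  filter_upwards [hev, hs.eventually_ge_atTop (K + 1)] with n hn hKn
  rw [Measure.map_apply_of_aemeasurable (h.forall_aemeasurable n) hclosed.measurableSet] at hn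
  refine le_trans (measure_mono fun ω hω => ?_) hn.le
  have hω' : ε ≤ |T n ω - m| := hω
  simp only [Set.mem_preimage, Set.mem_ofPred_eq, abs_mul, abs_of_nonneg (Real.sqrt_nonneg _)]
  exact hKn.trans (by gcongr)

/-! ### The constants and the regression -/

lemma lam_pos {σ : ℝ} (hσ : 0 < σ) (H : ℝ) (j : ℕ) : 0 < lam σ H j := by
  unfold lam
  positivity

/-- Since `p (1 - p) ≤ 1/4`, the constant is at least `log 2`. -/
lemma cCoef_pos {α p : ℝ} (hα : α ∈ Set.Icc (0 : ℝ) 1) (hp : p ∈ Set.Ioo (0 : ℝ) (1 / 2)) :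
    0 < cCoef α p := by
  obtain ⟨hp0, hp2⟩ := hp
  have hpp : 0 < p * (1 - p) := mul_pos hp0 (by linarith)
  have h2 : 0 < Real.log 2 := Real.log_pos (by norm_num)
  have h4 : 2 * Real.log 2 ≤ Real.log (1 / (p * (1 - p))) := by
    rw [show (2 : ℝ) * Real.log 2 = Real.log (2 ^ 2) by rw [Real.log_pow]; norm_num]
    refine Real.log_le_log (by norm_num) ?_
    rw [le_div_iff₀ hpp]
    nlinarith [sq_nonneg (2 * p - 1)]
  unfold cCoef
  nlinarith [hα.1, hα.2]

lemma fCoef_pos (α : ℝ) {p : ℝ} (hp : p ∈ Set.Ioo (0 : ℝ) (1 / 2)) : 0 < fCoef α p := by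
  obtain ⟨hp0, hp2⟩ := hp
  have h1 : 0 < 1 - p := by linarith
  have h2 : 0 < 1 - 2 * p := by linarith
  -- Complete the square in `α`; every remaining term is positive for `0 < p < 1/2`.
  have h : fCoef α p = ((1 - 2 * p) * (α - 2 * p) ^ 2 + 4 * p * ((1 - 2 * p) + 2 * p ^ 2))
      / (4 * p * (1 - p)) := by
    unfold fCoef
    field_simp
    ring
  rw [h]
  positivity

lemma lsSlope_affine {S : Finset ℕ} (hS : 2 ≤ S.card) (a b : ℝ) :
    lsSlope S (fun j => a + b * j) = b := by
  have hc : (S.card : ℝ) ≠ 0 := by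
    have : S.card ≠ 0 := by omega
    exact_mod_cast this
  unfold lsSlope
  set m : ℝ := (∑ l ∈ S, (l : ℝ)) / S.card with hm
  have hmean : (∑ l ∈ S, (a + b * (l : ℝ))) / S.card = a + b * m := by
    rw [Finset.sum_add_distrib, ← Finset.mul_sum, Finset.sum_const, nsmul_eq_mul, hm]
    field_simp
  -- Otherwise every level would equal the mean, although `S` has two distinct elements.
  have hne : ∑ j ∈ S, ((j : ℝ) - m) ^ 2 ≠ 0 := by
    intro h0
    rw [Finset.sum_eq_zero_iff_of_nonneg fun _ _ => sq_nonneg _] at h0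
    obtain ⟨x, hx, y, hy, hxy⟩ := Finset.one_lt_card.1 hS
    have h1 := pow_eq_zero_iff two_ne_zero |>.1 (h0 x hx)
    have h2 := pow_eq_zero_iff two_ne_zero |>.1 (h0 y hy)
    exact hxy (by exact_mod_cast (by linarith : (x : ℝ) = y))
  rw [div_eq_iff hne, Finset.mul_sum]
  refine Finset.sum_congr rfl fun j _ => ?_
  rw [hmean]
  ring

lemma tendsto_lsSlope {ι : Type*} {F : Filter ι} {S : Finset ℕ} {y : ι → ℕ → ℝ} {z : ℕ → ℝ}
    (h : ∀ j ∈ S, Tendsto (fun x => y x j) F (𝓝 (z j))) :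
    Tendsto (fun x => lsSlope S (y x)) F (𝓝 (lsSlope S z)) := by
  unfold lsSlope
  refine Tendsto.div_const (tendsto_finsetSum _ fun j hj => ?_) _
  exact ((h j hj).sub ((tendsto_finsetSum _ h).div_const _)).const_mul _

lemma logb_mul_lam {c σ : ℝ} (hc : 0 < c) (hσ : 0 < σ) (H : ℝ) (j : ℕ) :
    Real.logb 2 (c * lam σ H j) = Real.logb 2 (c * σ ^ 2) + -(2 * H + 1) * j := by
  rw [lam, ← mul_assoc, Real.logb_mul (by positivity) (by positivity),
    Real.logb_rpow (by norm_num) (by norm_num)]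

lemma hurstHat_eq {M : ℕ} (hM : 1 ≤ M) (α p : ℝ) (n : ℕ) (S : Finset ℕ) (d : ℕ → ℕ → ℝ) :
    hurstHat α p M n S d = -betaBar α p M n S d / 2 - 1 / 2 := by
  have hM0 : (M : ℝ) ≠ 0 := by
    have : M ≠ 0 := by omega
    exact_mod_cast this
  simp only [hurstHat, betaBar, hurstHatGroup, Finset.sum_sub_distrib, neg_div,
    Finset.sum_neg_distrib, ← Finset.sum_div, Finset.sum_const, Nat.card_Icc, nsmul_eq_mul]
  push_cast
  field_simp

end GTME

/-- The `n`-th experiment has signal size `N = 2 M n`; `d n j k` is the `k`-th NDWT coefficient at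
level `j` (`1 ≤ k ≤ N`, `1 ≤ j ≤ J`). Nothing is assumed about the dependence between different
levels, or between different subgroups. -/
theorem theorem1
    (M J : ℕ) (hM : 1 ≤ M)
    (H : ℝ) (hH : H ∈ Set.Ioo (0 : ℝ) 1) (σ : ℝ) (hσ : 0 < σ)
    (α : ℝ) (hα : α ∈ Set.Icc (0 : ℝ) 1) (p : ℝ) (hp : p ∈ Set.Ioo (0 : ℝ) (1 / 2))
    {Ω : ℕ → Type*} [∀ n, MeasurableSpace (Ω n)]
    (P : ∀ n, Measure (Ω n)) [∀ n, IsProbabilityMeasure (P n)]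
    (d : ∀ n, ℕ → ℕ → Ω n → ℝ)
    (hlaw : ∀ n, ∀ j ∈ Finset.Icc 1 J, ∀ k ∈ Finset.Icc 1 (2 * M * n),
      HasLaw (d n j k) (gaussianReal 0 (Real.toNNReal (GTME.lam σ H j))) (P n))
    (hpair : ∀ n, ∀ j ∈ Finset.Icc 1 J, ∀ k ∈ Finset.Icc 1 (M * n),
      IndepFun (d n j k) (d n j (k + M * n)) (P n))
    (hgroup : ∀ n, ∀ j ∈ Finset.Icc 1 J, ∀ i ∈ Finset.Icc 1 M,
      iIndepFun (fun (t : Fin n) (ω : Ω n) => GTME.subgroup M n (fun k => d n j k ω) i t) (P n)) :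
    -- asymptotic normality of the general trimean of every subgroup at every level
    (0 < GTME.fCoef α p ∧
      ∀ j ∈ Finset.Icc 1 J, ∀ i ∈ Finset.Icc 1 M,
        TendstoInDistribution
          (fun (n : ℕ) (ω : Ω n) =>
            Real.sqrt (((2 * M * n : ℕ) : ℝ) / (2 * M)) *
              (GTME.muHat α p M n (fun k => d n j k ω) i - GTME.cCoef α p * GTME.lam σ H j))
          atTop (id : ℝ → ℝ) P
          (gaussianReal 0 (Real.toNNReal (GTME.fCoef α p * GTME.lam σ H j ^ 2)))) ∧
    -- estimation of the Hurst exponent by regression on any set of at least two levels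
    ∀ S ⊆ Finset.Icc 1 J, 2 ≤ S.card →
      -- the asymptotic means lie on a line whose slope gives back `H`
      -GTME.lsSlope S (fun j => Real.logb 2 (GTME.cCoef α p * GTME.lam σ H j)) / 2 - 1 / 2 = H ∧
      -- the two expressions for the estimator agree
      (∀ (n : ℕ) (ω : Ω n),
        GTME.hurstHat α p M n S (fun j k => d n j k ω) =
          -GTME.betaBar α p M n S (fun j k => d n j k ω) / 2 - 1 / 2) ∧
      -- consistency of each group estimator and of their average
      (∀ i ∈ Finset.Icc 1 M, ∀ ε : ℝ, 0 < ε →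
        Tendsto (fun n => P n {ω | ε ≤
          |GTME.hurstHatGroup α p M n S (fun j k => d n j k ω) i - H|}) atTop (𝓝 0)) ∧
      (∀ ε : ℝ, 0 < ε →
        Tendsto (fun n => P n {ω | ε ≤
          |GTME.hurstHat α p M n S (fun j k => d n j k ω) - H|}) atTop (𝓝 0)) := by
  have hl := fun j => GTME.lam_pos hσ H j
  have hc := GTME.cCoef_pos hα hp
  have hM0 : (M : ℝ) ≠ 0 := by
    have : M ≠ 0 := by omega
    exact_mod_cast this
  have hclt : ∀ j ∈ Finset.Icc 1 J, ∀ i ∈ Finset.Icc 1 M,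
      TendstoInDistribution (fun (n : ℕ) (ω : Ω n) =>
        √n * (GTME.muHat α p M n (fun k => d n j k ω) i - GTME.cCoef α p * GTME.lam σ H j))
        atTop (id : ℝ → ℝ) P
        (gaussianReal 0 (Real.toNNReal (GTME.fCoef α p * GTME.lam σ H j ^ 2))) := by
    intro j hj i hi
    obtain ⟨hi1, hiM⟩ := Finset.mem_Icc.1 hi
    refine GTME.tendstoInDistribution_generalTrimean_array
      (Y := fun n t ω => GTME.subgroup M n (fun k => d n j k ω) i t) (hl j) (fun n t => ?_)
      (fun n => hgroup n j hj i hi) α hp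
    -- From `i ≤ M` and `t + 1 ≤ n`: the index stays in the first half, so its partner at distance
    -- `N/2 = M n` is at most `N`.
    have hk : i + t * M ≤ M * n := by
      have := Nat.mul_le_mul_right M (Nat.succ_le_of_lt t.2)
      rw [Nat.succ_mul, mul_comm n] at this
      omega
    have hN : 2 * M * n / 2 = M * n := by rw [mul_assoc]; omega
    have hN' : 2 * M * n = 2 * (M * n) := by ring
    have h := GTME.hasLaw_half_sq_add_sq (v := Real.toNNReal (GTME.lam σ H j))
      (Real.toNNReal_pos.2 (hl j)).ne'
      (hlaw n j hj (i + t * M) (Finset.mem_Icc.2 ⟨by omega, by omega⟩))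
      (hlaw n j hj (i + t * M + M * n) (Finset.mem_Icc.2 ⟨by omega, by omega⟩))
      (hpair n j hj _ (Finset.mem_Icc.2 ⟨by omega, hk⟩))
    rw [Real.coe_toNNReal _ (hl j).le] at h
    simpa only [GTME.subgroup, GTME.midEnergy, hN] using h
  refine ⟨⟨GTME.fCoef_pos α hp, fun j hj i hi => ?_⟩, fun S hS hcard => ?_⟩
  · have hn : ∀ n : ℕ, ((2 * M * n : ℕ) : ℝ) / (2 * M) = n := fun n => by
      push_cast
      field_simp
    simp only [hn]
    exact hclt j hj i hi
  have hslope : -GTME.lsSlope S (fun j => Real.logb 2 (GTME.cCoef α p * GTME.lam σ H j)) / 2 - 1 / 2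
      = H := by
    simp only [GTME.logb_mul_lam hc hσ]
    rw [GTME.lsSlope_affine hcard]
    ring
  have hgrp : ∀ i ∈ Finset.Icc 1 M, Tendsto (fun x : Σ n, Ω n =>
      GTME.hurstHatGroup α p M x.1 S (fun j k => d x.1 j k x.2) i) (GTME.inProb P) (𝓝 H) := by
    intro i hi
    -- Writing `H` as the same functional of the limits `log₂ (c λ_j)` reduces the claim to
    -- continuity.
    rw [← hslope]
    refine ((GTME.tendsto_lsSlope fun j hj => ?_).neg.div_const 2).sub_const (1 / 2)
    have hmu := GTME.tendsto_inProb_of_tendstoInDistribution (hclt j (hS hj) i hi)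
    exact (hmu.log (mul_pos hc (hl j)).ne').div_const _
  refine ⟨hslope, fun n ω => GTME.hurstHat_eq hM α p n S _, fun i hi => ?_, ?_⟩
  · exact GTME.tendsto_inProb_iff.1 (hgrp i hi)
  · have h := (tendsto_finsetSum (Finset.Icc 1 M) hgrp).const_mul (1 / (M : ℝ))
    have hH : 1 / (M : ℝ) * ∑ _i ∈ Finset.Icc 1 M, H = H := by
      simp [hM0]
    rw [hH] at h
    exact GTME.tendsto_inProb_iff.1 h
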